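/- Let $\Omega\subset\mathbb R^2$ be a bounded polygonal domain, i.e. a bounded connected open set whose boundary $\Gamma=\partial\Omega$ is a simple closed polygon; $\Omega$ need not be convex. All functions are real-valued, and $(\cdot,\cdot)_\Omega$ is the scalar product of $L^2(\Omega)$. Let $$V:=\{v\in H^1_0(\Omega):\ \Delta v\in L^2(\Omega)\},\qquad \|v\|_V:=\|\Delta v\|_{L^2(\Omega)},$$ where $\Delta v$ is the distributional Laplacian. For $v\in V$ the normal derivative $\partial_n v$ is the functional on boundary functions defined by Green's formula $$(\partial_n v,\varphi|_\Gamma)_\Gamma=(\nabla v,\nabla\varphi)_\Omega+(\Delta v,\varphi)_\Omega\qquad\text{for all }\varphi\in C_c^\infty(\mathbb R^2).$$ Let $V_\Gamma:=\{\partial_n v: v\in V\}$ with the norm $\|g\|_{V_\Gamma}:=\inf\{\|v\|_V: v\in V,\ \partial_n v=g\}$, and let $V'$ and $V_\Gamma'$ be the dual spaces of $V$ and $V_\Gamma$ with the dual norms. Below, $(f,v)_\Omega$ and $(u,g)_\Gamma$ also denote the corresponding duality pairings. Let $f\in V'$ and $u\in V_\Gamma'$. Then there exists a unique $y\in L^2(\Omega)$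 such that $$(y,\Delta v)_\Omega=(u,\partial_n v)_\Gamma-(f,v)_\Omega\qquad\text{for all }v\in V,$$ and it satisfies $$\|y\|_{L^2(\Omega)}\le\|u\|_{V_\Gamma'}+\|f\|_{V'}.$$ -/

import Mathlib

open MeasureTheory TopologicalSpace Set Filter
open scoped Distributions LineDeriv ContDiff Topology

namespace VeryWeak

noncomputable section

/-- The Euclidean plane. -/
abbrev Plane : Type := EuclideanSpace ℝ (Fin 2)

/-- The `i`-th coordinate direction; `∂_{e i} φ` is the `i`-th partial derivative of `φ`. -/
abbrev e (i : Fin 2) : Plane := EuclideanSpace.single i (1 : ℝ)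

/-! ### Polygonal domains -/

/-- A closed polygon in the plane without self-intersections: at least three vertices, all
different, and two different edges meet at most in a common end point. -/
structure IsSimplePolygon {n : ℕ} (P : Polygon Plane n) : Prop where
  three_le : 3 ≤ n
  injective : Function.Injective P.vertices
  inter_subset : ∀ i j, i ≠ j → P.edgeSet ℝ i ∩ P.edgeSet ℝ j ⊆
    {P i, P (finRotate n i)} ∩ {P j, P (finRotate n j)}

/-- A bounded polygonal domain: a bounded connected open set whose boundary is a simple closed
polygon. It may be non-convex, with any number of non-convex corners. -/
structure IsPolygonalDomain (Ω : Opens Plane) : Prop where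
  connected : IsConnected (Ω : Set Plane)
  bounded : Bornology.IsBounded (Ω : Set Plane)
  frontier_eq : ∃ (n : ℕ) (P : Polygon Plane n), IsSimplePolygon P ∧
    frontier (Ω : Set Plane) = P.boundary ℝ

/-! ### Lebesgue and Sobolev spaces -/

/-- The real Hilbert space `L²(Ω)`; its inner product is `(w, v)_Ω = ∫_Ω w v`. -/
abbrev LTwo (Ω : Opens Plane) : Type := Lp ℝ 2 (volume.restrict (Ω : Set Plane))

/-- A smooth compactly supported function on an open set `U`, restricted to `Ω` and regarded as an
element of `L²(Ω)`. -/
def toLTwo (Ω : Opens Plane) {U : Opens Plane} : 𝓓(U, ℝ) →ₗ[ℝ] LTwo Ω where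
  toFun φ := MemLp.toLp φ (φ.continuous.memLp_of_hasCompactSupport φ.hasCompactSupport)
  map_add' φ ψ := by rfl
  map_smul' c φ := by rfl

theorem toLTwo_coe (Ω : Opens Plane) {U : Opens Plane} (φ : 𝓓(U, ℝ)) :
    toLTwo Ω φ =ᵐ[volume.restrict (Ω : Set Plane)] φ :=
  MemLp.coeFn_toLp (φ.continuous.memLp_of_hasCompactSupport φ.hasCompactSupport)

theorem inner_toLTwo (Ω : Opens Plane) {U : Opens Plane} (g : LTwo Ω) (φ : 𝓓(U, ℝ)) :
    inner ℝ g (toLTwo Ω φ) = ∫ x in (Ω : Set Plane), g x * φ x := by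
  rw [L2.inner_def]
  apply integral_congr_ae
  filter_upwards [toLTwo_coe Ω φ] with x hx
  simp [hx, mul_comm]

theorem eq_zero_of_inner_toLTwo (Ω : Opens Plane) (g : LTwo Ω)
    (h : ∀ φ : 𝓓(Ω, ℝ), inner ℝ g (toLTwo Ω φ) = 0) : g = 0 := by
  have key : ∀ᵐ x, x ∈ (Ω : Set Plane) → g x = 0 := by
    refine Ω.isOpen.ae_eq_zero_of_integral_contDiff_smul_eq_zero ?_ ?_
    · exact locallyIntegrableOn_of_locallyIntegrable_restrict
        ((Lp.memLp g).locallyIntegrable (by norm_num))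
    · intro f hf hc hs
      have := h ⟨f, hf, hc, hs⟩
      rw [inner_toLTwo] at this
      rw [← this, ← setIntegral_eq_integral_of_forall_compl_eq_zero (s := (Ω : Set Plane))]
      · simp [mul_comm]
      · intro x hx
        have : f x = 0 := by
          by_contra h0
          exact hx (hs (subset_tsupport _ h0))
        simp [this]
  rw [Lp.eq_zero_iff_ae_eq_zero]
  exact (ae_restrict_iff' Ω.isOpen.measurableSet).2 key

/-- `g` is the weak partial derivative `∂_i v` in `Ω`: `(v, ∂_i φ)_Ω = -(g, φ)_Ω` for all
`φ ∈ C_c^∞(Ω)`. -/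
def HasWeakPartial (Ω : Opens Plane) (i : Fin 2) (v g : LTwo Ω) : Prop :=
  ∀ φ : 𝓓(Ω, ℝ), inner ℝ v (toLTwo Ω (∂_{e i} φ)) = -inner ℝ g (toLTwo Ω φ)

/-- `w` is the weak Laplacian `Δ v` in `Ω`: `(v, Δ φ)_Ω = (w, φ)_Ω` for all
`φ ∈ C_c^∞(Ω)`. -/
def HasWeakLaplacian (Ω : Opens Plane) (v w : LTwo Ω) : Prop :=
  ∀ φ : 𝓓(Ω, ℝ), inner ℝ v (toLTwo Ω (∑ i, ∂_{e i} (∂_{e i} φ))) = inner ℝ w (toLTwo Ω φ)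

theorem HasWeakPartial.unique {Ω : Opens Plane} {i : Fin 2} {v g g' : LTwo Ω}
    (h : HasWeakPartial Ω i v g) (h' : HasWeakPartial Ω i v g') : g = g' := by
  rw [← sub_eq_zero]
  refine eq_zero_of_inner_toLTwo Ω _ fun φ => ?_
  rw [inner_sub_left]
  linarith [h φ, h' φ]

theorem HasWeakPartial.add {Ω : Opens Plane} {i : Fin 2} {v v' g g' : LTwo Ω}
    (h : HasWeakPartial Ω i v g) (h' : HasWeakPartial Ω i v' g') :
    HasWeakPartial Ω i (v + v') (g + g') := by
  intro φ
  rw [inner_add_left, inner_add_left, h φ, h' φ]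
  ring

theorem HasWeakPartial.smul {Ω : Opens Plane} {i : Fin 2} {v g : LTwo Ω} (c : ℝ)
    (h : HasWeakPartial Ω i v g) : HasWeakPartial Ω i (c • v) (c • g) := by
  intro φ
  rw [real_inner_smul_left, real_inner_smul_left, h φ]
  ring

theorem HasWeakLaplacian.unique {Ω : Opens Plane} {v w w' : LTwo Ω}
    (h : HasWeakLaplacian Ω v w) (h' : HasWeakLaplacian Ω v w') : w = w' := by
  rw [← sub_eq_zero]
  refine eq_zero_of_inner_toLTwo Ω _ fun φ => ?_
  rw [inner_sub_left]
  linarith [h φ, h' φ]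

theorem HasWeakLaplacian.add {Ω : Opens Plane} {v v' w w' : LTwo Ω}
    (h : HasWeakLaplacian Ω v w) (h' : HasWeakLaplacian Ω v' w') :
    HasWeakLaplacian Ω (v + v') (w + w') := by
  intro φ
  rw [inner_add_left, inner_add_left, h φ, h' φ]

theorem HasWeakLaplacian.smul {Ω : Opens Plane} {v w : LTwo Ω} (c : ℝ)
    (h : HasWeakLaplacian Ω v w) : HasWeakLaplacian Ω (c • v) (c • w) := by
  intro φ
  rw [real_inner_smul_left, real_inner_smul_left, h φ]

/-- The Sobolev space `H¹(Ω)`: functions in `L²(Ω)` with weak first derivatives in `L²(Ω)`. -/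
def HOne (Ω : Opens Plane) : Submodule ℝ (LTwo Ω) where
  carrier := {v | ∀ i, ∃ g, HasWeakPartial Ω i v g}
  add_mem' hv hw i := by
    obtain ⟨g, hg⟩ := hv i
    obtain ⟨g', hg'⟩ := hw i
    exact ⟨_, hg.add hg'⟩
  zero_mem' i := ⟨0, fun φ => by simp⟩
  smul_mem' c v hv i := by
    obtain ⟨g, hg⟩ := hv i
    exact ⟨_, hg.smul c⟩

/-- The weak partial derivative `∂_i : H¹(Ω) → L²(Ω)`. -/
def weakPartial (Ω : Opens Plane) (i : Fin 2) : HOne Ω →ₗ[ℝ] LTwo Ω where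
  toFun v := (v.2 i).choose
  map_add' v w :=
    (((v + w).2 i).choose_spec).unique ((v.2 i).choose_spec.add (w.2 i).choose_spec)
  map_smul' c v := (((c • v).2 i).choose_spec).unique ((v.2 i).choose_spec.smul c)

theorem weakPartial_spec (Ω : Opens Plane) (i : Fin 2) (v : HOne Ω) :
    HasWeakPartial Ω i v (weakPartial Ω i v) :=
  (v.2 i).choose_spec

/-- `φ ∈ C_c^∞(Ω)` together with its gradient, in `L²(Ω) × L²(Ω)²`. -/
def testGraph (Ω : Opens Plane) : 𝓓(Ω, ℝ) →ₗ[ℝ] LTwo Ω × (Fin 2 → LTwo Ω) where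
  toFun φ := (toLTwo Ω φ, fun i => toLTwo Ω (∂_{e i} φ))
  map_add' φ ψ := by
    simp only [LineDeriv.lineDerivOp_add, map_add]
    rfl
  map_smul' c φ := by
    simp only [LineDeriv.lineDerivOp_smul, map_smul]
    rfl

/-- `v ↦ (v, ∇ v)`, from `H¹(Ω)` to `L²(Ω) × L²(Ω)²`. -/
def sobolevGraph (Ω : Opens Plane) : HOne Ω →ₗ[ℝ] LTwo Ω × (Fin 2 → LTwo Ω) :=
  (HOne Ω).subtype.prod (LinearMap.pi (weakPartial Ω))

/-- The Sobolev space `H¹_0(Ω)`, as a subspace of `H¹(Ω)`: the closure of `C_c^∞(Ω)` with respect to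
convergence of the function and of its gradient in `L²`. -/
def HOneZero (Ω : Opens Plane) : Submodule ℝ (HOne Ω) :=
  (LinearMap.range (testGraph Ω)).topologicalClosure.comap (sobolevGraph Ω)

/-- `H¹_Δ(Ω) = {v ∈ H¹(Ω) : Δ v ∈ L²(Ω)}`, as a subspace of `H¹(Ω)`. -/
def HOneDelta (Ω : Opens Plane) : Submodule ℝ (HOne Ω) where
  carrier := {v | ∃ w, HasWeakLaplacian Ω v w}
  add_mem' := by
    rintro v v' ⟨w, hw⟩ ⟨w', hw'⟩
    exact ⟨_, hw.add hw'⟩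
  zero_mem' := ⟨0, fun φ => by simp⟩
  smul_mem' := by
    rintro c v ⟨w, hw⟩
    exact ⟨_, hw.smul c⟩

/-- The Laplacian `Δ : H¹_Δ(Ω) → L²(Ω)`. -/
def lapDelta (Ω : Opens Plane) : HOneDelta Ω →ₗ[ℝ] LTwo Ω where
  toFun v := v.2.choose
  map_add' v w := ((v + w).2.choose_spec).unique (v.2.choose_spec.add w.2.choose_spec)
  map_smul' c v := ((c • v).2.choose_spec).unique (v.2.choose_spec.smul c)

theorem lapDelta_spec (Ω : Opens Plane) (v : HOneDelta Ω) :
    HasWeakLaplacian Ω v (lapDelta Ω v) :=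
  v.2.choose_spec

/-! ### The test space `V` -/

/-- The test space `V = H¹_0(Ω) ∩ H¹_Δ(Ω)`. -/
def V (Ω : Opens Plane) : Type := ↥(HOneZero Ω ⊓ HOneDelta Ω)

instance (Ω : Opens Plane) : AddCommGroup (V Ω) :=
  inferInstanceAs (AddCommGroup ↥(HOneZero Ω ⊓ HOneDelta Ω))

instance (Ω : Opens Plane) : Module ℝ (V Ω) :=
  inferInstanceAs (Module ℝ ↥(HOneZero Ω ⊓ HOneDelta Ω))

/-- The inclusion `V ⊆ H¹_Δ(Ω)`. -/
def V.incl (Ω : Opens Plane) : V Ω →ₗ[ℝ] HOneDelta Ω :=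
  Submodule.inclusion (inf_le_right : HOneZero Ω ⊓ HOneDelta Ω ≤ HOneDelta Ω)

/-- The Laplacian `Δ : V → L²(Ω)`. -/
def lap (Ω : Opens Plane) : V Ω →ₗ[ℝ] LTwo Ω := lapDelta Ω ∘ₗ V.incl Ω

/-- `V` is normed by `‖v‖_V = ‖Δ v‖_{L²(Ω)}`. Definiteness, which holds for bounded `Ω`, is not needed
to form the dual space `V'`, whose norm is the usual operator norm. -/
instance (Ω : Opens Plane) : SeminormedAddCommGroup (V Ω) :=
  SeminormedAddCommGroup.induced (V Ω) (LTwo Ω) (lap Ω)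

instance (Ω : Opens Plane) : NormedSpace ℝ (V Ω) :=
  NormedSpace.induced ℝ (V Ω) (LTwo Ω) (lap Ω)

theorem V.norm_def (Ω : Opens Plane) (v : V Ω) : ‖v‖ = ‖lap Ω v‖ := rfl

/-! ### The normal derivative -/

/-- Restriction to the boundary `Γ = ∂Ω` of smooth compactly supported functions on the plane. -/
def boundaryRestrict (Ω : Opens Plane) :
    𝓓((⊤ : Opens Plane), ℝ) →ₗ[ℝ] (frontier (Ω : Set Plane) → ℝ) where
  toFun φ x := φ x
  map_add' φ ψ := by rfl
  map_smul' c φ := by rfl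

/-- The functions on `Γ = ∂Ω` that have a smooth extension to the plane. -/
abbrev BoundaryFun (Ω : Opens Plane) : Type := ↥(LinearMap.range (boundaryRestrict Ω))

/-- The bilinear form `(∇ v, ∇ φ)_Ω + (Δ v, φ)_Ω` of Green's formula. -/
def green (Ω : Opens Plane) : HOneDelta Ω →ₗ[ℝ] 𝓓((⊤ : Opens Plane), ℝ) →ₗ[ℝ] ℝ :=
  LinearMap.mk₂ ℝ (fun v φ => ∑ i, inner ℝ (weakPartial Ω i v) (toLTwo Ω (∂_{e i} φ)) +
      inner ℝ (lapDelta Ω v) (toLTwo Ω φ))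
    (by
      intro v w φ
      simp only [Submodule.coe_add, map_add, inner_add_left, Finset.sum_add_distrib]
      ring)
    (by
      intro c v φ
      simp only [Submodule.coe_smul, map_smul, real_inner_smul_left, ← Finset.mul_sum, smul_eq_mul]
      ring)
    (by
      intro v φ ψ
      simp only [LineDeriv.lineDerivOp_add, map_add, inner_add_right, Finset.sum_add_distrib]
      ring)
    (by
      intro c v φ
      simp only [LineDeriv.lineDerivOp_smul, map_smul, real_inner_smul_right, ← Finset.mul_sum,
        smul_eq_mul]
      ring)

/-- A bounded sequence in `L²(Ω)` converges weakly to zero if it does so against test functions. -/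
theorem tendsto_inner_of_test (Ω : Opens Plane) (f : ℕ → LTwo Ω) (C : ℝ) (hC : ∀ n, ‖f n‖ ≤ C)
    (h : ∀ η : 𝓓(Ω, ℝ), Tendsto (fun n => inner ℝ (f n) (toLTwo Ω η)) atTop (𝓝 0))
    (g : LTwo Ω) : Tendsto (fun n => inner ℝ g (f n)) atTop (𝓝 0) := by
  suffices hs : Tendsto (fun n => inner ℝ (f n) g) atTop (𝓝 0) from
    hs.congr fun n => real_inner_comm _ _
  have hd : (LinearMap.range (toLTwo Ω : 𝓓(Ω, ℝ) →ₗ[ℝ] LTwo Ω)).topologicalClosure = ⊤ := by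
    rw [Submodule.topologicalClosure_eq_top_iff, Submodule.eq_bot_iff]
    intro x hx
    refine eq_zero_of_inner_toLTwo Ω x fun φ => ?_
    rw [real_inner_comm]
    exact hx _ ⟨φ, rfl⟩
  have hg : g ∈ closure (LinearMap.range (toLTwo Ω : 𝓓(Ω, ℝ) →ₗ[ℝ] LTwo Ω) : Set (LTwo Ω)) := by
    rw [← Submodule.topologicalClosure_coe, hd]
    trivial
  have hC0 : 0 ≤ C := (norm_nonneg _).trans (hC 0)
  rw [Metric.tendsto_atTop]
  intro ε hε
  obtain ⟨_, ⟨η, rfl⟩, hη⟩ := Metric.mem_closure_iff.1 hg (ε / (2 * (C + 1))) (by positivity)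
  obtain ⟨N, hN⟩ := Metric.tendsto_atTop.1 (h η) (ε / 2) (by positivity)
  refine ⟨N, fun n hn => ?_⟩
  have h1 := hN n hn
  rw [Real.dist_eq, sub_zero] at h1 ⊢
  have h2 : inner ℝ (f n) g = inner ℝ (f n) (g - toLTwo Ω η) + inner ℝ (f n) (toLTwo Ω η) := by
    rw [← inner_add_right, sub_add_cancel]
  have h3 : |inner ℝ (f n) (g - toLTwo Ω η)| ≤ C * (ε / (2 * (C + 1))) := by
    refine (abs_real_inner_le_norm _ _).trans ?_
    rw [dist_eq_norm] at hη
    exact mul_le_mul (hC n) hη.le (norm_nonneg _) hC0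
  have h4 : C * (ε / (2 * (C + 1))) ≤ ε / 2 := by
    rw [show C * (ε / (2 * (C + 1))) = (ε / 2) * (C / (C + 1)) by field_simp]
    have : C / (C + 1) ≤ 1 := by
      rw [div_le_one (by positivity)]
      linarith
    nlinarith
  rw [h2]
  calc _ ≤ _ := abs_add_le _ _
    _ < ε := by linarith

theorem lineDeriv_apply' {U : Opens Plane} (φ : 𝓓(U, ℝ)) (v x : Plane) :
    (∂_{v} φ) x = fderiv ℝ φ x v := by
  rw [TestFunction.lineDerivOp_eq_lineDerivCLM ℝ, TestFunction.lineDerivCLM_apply_of_le (by simp)]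
  exact ((φ.contDiff.differentiable (by simp)).differentiableAt).lineDeriv_eq_fderiv

/-- Integration by parts between a smooth function and a test function on `Ω`. -/
theorem inner_lineDeriv (Ω : Opens Plane) {U : Opens Plane} (φ : 𝓓(U, ℝ)) (η : 𝓓(Ω, ℝ))
    (v : Plane) :
    inner ℝ (toLTwo Ω (∂_{v} φ)) (toLTwo Ω η) = -inner ℝ (toLTwo Ω φ) (toLTwo Ω (∂_{v} η)) := by
  have aux : ∀ (a : 𝓓(U, ℝ)) (b : 𝓓(Ω, ℝ)),
      inner ℝ (toLTwo Ω a) (toLTwo Ω b) = ∫ x, a x * b x := by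
    intro a b
    have h0 : inner ℝ (toLTwo Ω a) (toLTwo Ω b) = ∫ x in (Ω : Set Plane), a x * b x := by
      rw [inner_toLTwo]
      apply integral_congr_ae
      filter_upwards [toLTwo_coe Ω a] with x hx
      rw [hx]
    rw [h0]
    apply setIntegral_eq_integral_of_forall_compl_eq_zero
    · intro x hx
      have : b x = 0 := by
        by_contra h0
        exact hx (b.tsupport_subset (subset_tsupport _ h0))
      simp [this]
  have hint : ∀ (a : 𝓓(U, ℝ)) (b : 𝓓(Ω, ℝ)), Integrable (fun x => a x * b x) := fun a b =>
    (a.continuous.mul b.continuous).integrable_of_hasCompactSupport a.hasCompactSupport.mul_right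
  rw [aux, aux]
  have h1 := hint (∂_{v} φ) η
  have h2 := hint φ (∂_{v} η)
  simp only [lineDeriv_apply'] at h1 h2 ⊢
  rw [integral_mul_fderiv_eq_neg_fderiv_mul_of_integrable h1 h2 (hint φ η)
    (fun x _ => (φ.contDiff.differentiable (by simp)).differentiableAt)
    (fun x _ => (η.contDiff.differentiable (by simp)).differentiableAt), neg_neg]

/-- A smooth approximation of the identity of the line that vanishes near zero. -/
theorem exists_cutoff : ∃ (θ : ℝ → ℝ) (C : ℝ), ContDiff ℝ ∞ θ ∧ 0 ≤ C ∧
    (∀ s, |s| < 1 → θ s = 0) ∧ (∀ s, |θ s - s| ≤ C) ∧ (∀ s, |θ s| ≤ |s|) ∧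
    ∀ s, |deriv θ s| ≤ C := by
  let b : ContDiffBump (0 : ℝ) := ⟨1, 2, by norm_num, by norm_num⟩
  have hs : ContDiff ℝ ∞ (fun s : ℝ => s * b s) := contDiff_id.mul b.contDiff
  have hc : HasCompactSupport (fun s : ℝ => s * b s) := b.hasCompactSupport.mul_left
  obtain ⟨C₁, h₁⟩ := hs.continuous.bounded_above_of_compact_support hc
  obtain ⟨C₂, h₂⟩ := (hs.continuous_deriv (by simp)).bounded_above_of_compact_support hc.deriv
  have p₁ : 0 ≤ C₁ := (norm_nonneg _).trans (h₁ 0)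
  have p₂ : 0 ≤ C₂ := (norm_nonneg _).trans (h₂ 0)
  refine ⟨fun s => s - s * b s, 1 + C₁ + C₂, contDiff_id.sub hs, by positivity, ?_, ?_, ?_, ?_⟩
  · intro s hs
    have : b s = 1 := b.one_of_mem_closedBall (by simpa using hs.le)
    simp [this]
  · intro s
    have := h₁ s
    rw [Real.norm_eq_abs] at this
    rw [show s - s * b s - s = -(s * b s) by ring, abs_neg]
    linarith
  · intro s
    change |s - s * b s| ≤ |s|
    rw [show s - s * b s = s * (1 - b s) by ring, abs_mul]
    have h0 : 0 ≤ b s := b.nonneg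
    have h1 : b s ≤ 1 := b.le_one
    have : |1 - b s| ≤ 1 := abs_le.2 ⟨by linarith, by linarith⟩
    nlinarith [abs_nonneg s]
  · intro s
    have hd : DifferentiableAt ℝ (fun s : ℝ => s * b s) s :=
      (hs.differentiable (by simp)).differentiableAt
    have : deriv (fun s : ℝ => s - s * b s) s = 1 - deriv (fun s : ℝ => s * b s) s := by
      exact ((hasDerivAt_id s).sub hd.hasDerivAt).deriv
    rw [this]
    have h2 := h₂ s
    rw [Real.norm_eq_abs] at h2
    calc _ ≤ |(1 : ℝ)| + |deriv (fun s : ℝ => s * b s) s| := abs_sub _ _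
      _ ≤ _ := by
        rw [abs_one]
        linarith

/-- Composing a smooth function that vanishes on `∂Ω` with a function that vanishes near zero gives
a test function on `Ω`. -/
theorem exists_test_of_cutoff (Ω : Opens Plane) (φ : 𝓓((⊤ : Opens Plane), ℝ))
    (h0 : boundaryRestrict Ω φ = 0) (θ : ℝ → ℝ) (hθ : ContDiff ℝ ∞ θ) (δ : ℝ) (hδ : 0 < δ)
    (hz : ∀ s, |s| < δ → θ s = 0) : ∃ ψ : 𝓓(Ω, ℝ), ∀ x ∈ Ω, ψ x = θ (φ x) := by
  classical
  let K : Set Plane := {x | δ ≤ |φ x|} ∩ closure (Ω : Set Plane)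
  have hK : IsClosed K :=
    (isClosed_le continuous_const φ.continuous.abs).inter isClosed_closure
  have hKΩ : K ⊆ (Ω : Set Plane) := by
    rintro x ⟨h1, h2⟩
    by_contra hx
    have hf : x ∈ frontier (Ω : Set Plane) := by
      rw [Ω.isOpen.frontier_eq]
      exact ⟨h2, hx⟩
    have : φ x = 0 := congrFun h0 ⟨x, hf⟩
    change δ ≤ |φ x| at h1
    rw [this, abs_zero] at h1
    linarith
  let ψ : Plane → ℝ := (Ω : Set Plane).indicator (fun x => θ (φ x))
  have hsupp : Function.support ψ ⊆ K := by
    intro x hx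
    have hxΩ : x ∈ (Ω : Set Plane) := by
      by_contra h
      exact hx (indicator_of_notMem h _)
    refine ⟨?_, subset_closure hxΩ⟩
    by_contra h
    change ¬ δ ≤ |φ x| at h
    rw [not_le] at h
    apply hx
    change (Ω : Set Plane).indicator (fun x => θ (φ x)) x = 0
    rw [indicator_of_mem hxΩ, hz _ h]
  have hts : tsupport ψ ⊆ K := closure_minimal hsupp hK
  have hKc : K ⊆ tsupport φ := by
    rintro x ⟨h1, -⟩
    apply subset_tsupport
    intro h
    change δ ≤ |φ x| at h1
    rw [h, abs_zero] at h1
    linarith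
  have hsm : ContDiff ℝ ∞ ψ := by
    rw [contDiff_iff_contDiffAt]
    intro x
    by_cases hx : x ∈ (Ω : Set Plane)
    · have : ψ =ᶠ[𝓝 x] fun x => θ (φ x) := by
        filter_upwards [Ω.isOpen.mem_nhds hx] with y hy
        exact indicator_of_mem hy _
      exact (hθ.comp φ.contDiff).contDiffAt.congr_of_eventuallyEq this
    · have : ψ =ᶠ[𝓝 x] fun _ => 0 := by
        filter_upwards [hK.isOpen_compl.mem_nhds (fun h => hx (hKΩ h))] with y hy
        by_contra h
        exact hy (hsupp h)
      exact contDiffAt_const.congr_of_eventuallyEq this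
  have hcs : HasCompactSupport ψ := HasCompactSupport.of_support_subset_isCompact
    (IsCompact.of_isClosed_subset φ.hasCompactSupport hK hKc) hsupp
  refine ⟨⟨ψ, hsm, hcs, hts.trans hKΩ⟩, ?_⟩
  intro x hx
  change (Ω : Set Plane).indicator (fun x => θ (φ x)) x = θ (φ x)
  exact indicator_of_mem (show x ∈ (Ω : Set Plane) from hx) _

/-- Green's form depends on the smooth function only through its values on `∂Ω`. -/
theorem green_eq_zero (Ω : Opens Plane) (v : HOneDelta Ω) (φ : 𝓓((⊤ : Opens Plane), ℝ))
    (h0 : boundaryRestrict Ω φ = 0) : green Ω v φ = 0 := by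
  obtain ⟨θ, C, hθ, hC, hz, hd, hl, hb⟩ := exists_cutoff
  have hN : ∀ n : ℕ, (0 : ℝ) < n + 1 := fun n => by positivity
  have hex : ∀ n : ℕ, ∃ ψ : 𝓓(Ω, ℝ),
      ∀ x ∈ Ω, ψ x = (n + 1 : ℝ)⁻¹ * θ ((n + 1 : ℝ) * φ x) := by
    intro n
    refine exists_test_of_cutoff Ω φ h0 (fun s => (n + 1 : ℝ)⁻¹ * θ ((n + 1 : ℝ) * s))
      (contDiff_const.mul (hθ.comp (contDiff_const.mul contDiff_id))) (n + 1 : ℝ)⁻¹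
      (inv_pos.2 (hN n)) ?_
    intro s hs
    rw [hz, mul_zero]
    rw [abs_mul, abs_of_pos (hN n)]
    calc _ < (n + 1 : ℝ) * (n + 1 : ℝ)⁻¹ := mul_lt_mul_of_pos_left hs (hN n)
      _ = 1 := mul_inv_cancel₀ (hN n).ne'
  choose ψ hψ using hex
  have hrel : ∀ _ : ℕ, ∀ᵐ x ∂(volume.restrict (Ω : Set Plane)), x ∈ (Ω : Set Plane) := fun _ =>
    ae_restrict_mem Ω.isOpen.measurableSet
  -- the approximations are bounded in `L²`
  have bd0 : ∀ n, ‖toLTwo Ω (ψ n)‖ ≤ 1 * ‖toLTwo Ω φ‖ := by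
    intro n
    apply Lp.norm_le_mul_norm_of_ae_le_mul
    filter_upwards [hrel n, toLTwo_coe Ω (ψ n), toLTwo_coe Ω φ] with x hx h1 h2
    rw [h1, h2, hψ n x hx, one_mul, norm_mul, norm_inv, Real.norm_of_nonneg (hN n).le,
      Real.norm_eq_abs, Real.norm_eq_abs, inv_mul_le_iff₀ (hN n)]
    refine (hl _).trans ?_
    rw [abs_mul, abs_of_pos (hN n)]
  have bd1 : ∀ i n, ‖toLTwo Ω (∂_{e i} (ψ n))‖ ≤ C * ‖toLTwo Ω (∂_{e i} φ)‖ := by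
    intro i n
    apply Lp.norm_le_mul_norm_of_ae_le_mul
    filter_upwards [hrel n, toLTwo_coe Ω (∂_{e i} (ψ n)), toLTwo_coe Ω (∂_{e i} φ)] with x hx h1 h2
    rw [h1, h2, lineDeriv_apply', lineDeriv_apply']
    have hev : (ψ n : Plane → ℝ) =ᶠ[𝓝 x] fun y => (n + 1 : ℝ)⁻¹ * θ ((n + 1 : ℝ) * φ y) := by
      filter_upwards [Ω.isOpen.mem_nhds hx] with y hy
      exact hψ n y hy
    have hφd : HasFDerivAt φ (fderiv ℝ φ x) x :=
      (φ.contDiff.differentiable (by simp)).differentiableAt.hasFDerivAt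
    have hθd : HasDerivAt θ (deriv θ ((n + 1 : ℝ) * φ x)) ((n + 1 : ℝ) * φ x) :=
      (hθ.differentiable (by simp)).differentiableAt.hasDerivAt
    have hfd := ((hθd.comp_hasFDerivAt x (hφd.const_mul (n + 1 : ℝ))).const_mul
      (n + 1 : ℝ)⁻¹).congr_of_eventuallyEq hev
    rw [hfd.fderiv]
    have : ((n + 1 : ℝ)⁻¹ • deriv θ ((n + 1 : ℝ) * φ x) • (n + 1 : ℝ) • fderiv ℝ φ x) (e i) =
        deriv θ ((n + 1 : ℝ) * φ x) * fderiv ℝ φ x (e i) := by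
      simp only [smul_apply, smul_eq_mul]
      field_simp
    rw [this, norm_mul]
    exact mul_le_mul_of_nonneg_right (hb _) (norm_nonneg _)
  -- they converge against test functions
  have lim0 : ∀ η : 𝓓(Ω, ℝ),
      Tendsto (fun n => inner ℝ (toLTwo Ω (ψ n) - toLTwo Ω φ) (toLTwo Ω η)) atTop (𝓝 0) := by
    intro η
    have hηi : Integrable η (volume.restrict (Ω : Set Plane)) :=
      (η.continuous.integrable_of_hasCompactSupport η.hasCompactSupport)
    have hlim : Tendsto (fun n : ℕ => (n + 1 : ℝ)⁻¹ *
        (C * ∫ x in (Ω : Set Plane), ‖η x‖)) atTop (𝓝 0) := by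
      have := (tendsto_one_div_add_atTop_nhds_zero_nat (𝕜 := ℝ)).mul_const
        (C * ∫ x in (Ω : Set Plane), ‖η x‖)
      simpa [one_div] using this
    refine squeeze_zero_norm (fun n => ?_) hlim
    rw [inner_toLTwo]
    refine (norm_integral_le_integral_norm _).trans ?_
    rw [← mul_assoc, ← integral_const_mul]
    refine integral_mono_of_nonneg (Eventually.of_forall fun x => norm_nonneg _)
      (hηi.norm.const_mul _) ?_
    filter_upwards [hrel n, toLTwo_coe Ω (ψ n), toLTwo_coe Ω φ,
      Lp.coeFn_sub (toLTwo Ω (ψ n)) (toLTwo Ω φ)] with x hx h1 h2 h3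
    rw [norm_mul, h3, Pi.sub_apply, h1, h2, hψ n x hx]
    refine mul_le_mul_of_nonneg_right ?_ (norm_nonneg _)
    have : (n + 1 : ℝ)⁻¹ * θ ((n + 1 : ℝ) * φ x) - φ x =
        (n + 1 : ℝ)⁻¹ * (θ ((n + 1 : ℝ) * φ x) - (n + 1 : ℝ) * φ x) := by
      have := (hN n).ne'
      field_simp
    rw [this, norm_mul, norm_inv, Real.norm_of_nonneg (hN n).le]
    exact mul_le_mul_of_nonneg_left (hd _) (inv_nonneg.2 (hN n).le)
  have lim1 : ∀ i (η : 𝓓(Ω, ℝ)), Tendsto (fun n =>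
      inner ℝ (toLTwo Ω (∂_{e i} (ψ n)) - toLTwo Ω (∂_{e i} φ)) (toLTwo Ω η)) atTop (𝓝 0) := by
    intro i η
    have := (lim0 (∂_{e i} η)).neg
    rw [neg_zero] at this
    refine this.congr fun n => ?_
    rw [inner_sub_left, inner_sub_left, inner_lineDeriv, inner_lineDeriv]
    ring
  -- hence weakly
  have w0 := tendsto_inner_of_test Ω _ (1 * ‖toLTwo Ω φ‖ + ‖toLTwo Ω φ‖)
    (fun n => (norm_sub_le _ _).trans (add_le_add_left (bd0 n) _)) lim0 (lapDelta Ω v)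
  have w1 := fun i => tendsto_inner_of_test Ω _
    (C * ‖toLTwo Ω (∂_{e i} φ)‖ + ‖toLTwo Ω (∂_{e i} φ)‖)
    (fun n => (norm_sub_le _ _).trans (add_le_add_left (bd1 i n) _)) (lim1 i) (weakPartial Ω i v)
  have hsum := (tendsto_finsetSum Finset.univ fun i _ => w1 i).add w0
  rw [Finset.sum_const_zero, add_zero] at hsum
  have hconst : ∀ n, (∑ i, inner ℝ (weakPartial Ω i v)
      (toLTwo Ω (∂_{e i} (ψ n)) - toLTwo Ω (∂_{e i} φ))) +
      inner ℝ (lapDelta Ω v) (toLTwo Ω (ψ n) - toLTwo Ω φ) = -green Ω v φ := by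
    intro n
    have hL := lapDelta_spec Ω v (ψ n)
    have hP : ∀ i, inner ℝ (v : LTwo Ω) (toLTwo Ω (∂_{e i} (∂_{e i} (ψ n)))) =
        -inner ℝ (weakPartial Ω i v) (toLTwo Ω (∂_{e i} (ψ n))) := fun i =>
      weakPartial_spec Ω i v (∂_{e i} (ψ n))
    rw [map_sum, inner_sum] at hL
    simp only [hP] at hL
    rw [Finset.sum_neg_distrib] at hL
    simp only [inner_sub_right, Finset.sum_sub_distrib, green, LinearMap.mk₂_apply]
    linarith
  simp only [hconst] at hsum
  have := tendsto_nhds_unique hsum tendsto_const_nhds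
  linarith

theorem symm_range_mk (Ω : Opens Plane) (φ : 𝓓((⊤ : Opens Plane), ℝ)) :
    (boundaryRestrict Ω).quotKerEquivRange.symm ⟨boundaryRestrict Ω φ, φ, rfl⟩ =
      (LinearMap.ker (boundaryRestrict Ω)).mkQ φ := by
  rw [LinearEquiv.symm_apply_eq]
  rfl

/-- The normal derivative `∂_n v` of `v ∈ H¹_Δ(Ω)`, as a linear functional on functions on `Γ`. It is
given by Green's formula `(∂_n v, φ|_Γ)_Γ = (∇ v, ∇ φ)_Ω + (Δ v, φ)_Ω`, whose right-hand side
depends on `φ` only through `φ|_Γ`. On a polygon the functions `φ|_Γ` are dense in `H^{1/2}(Γ)`, so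
this determines `∂_n v` as an element of `H^{-1/2}(Γ)`, and for smooth `v` it is integration against
`n · ∇ v`. -/
def normalDerivDelta (Ω : Opens Plane) :
    HOneDelta Ω →ₗ[ℝ] Module.Dual ℝ (BoundaryFun Ω) where
  toFun v := (LinearMap.ker (boundaryRestrict Ω)).liftQ (green Ω v)
      (fun φ hφ => green_eq_zero Ω v φ hφ) ∘ₗ
    (boundaryRestrict Ω).quotKerEquivRange.symm.toLinearMap
  map_add' v w := by
    ext ⟨_, φ, rfl⟩
    simp only [LinearMap.comp_apply, LinearEquiv.coe_coe, LinearMap.add_apply, symm_range_mk]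
    simp only [Submodule.mkQ_apply]
    erw [Submodule.liftQ_apply, Submodule.liftQ_apply, Submodule.liftQ_apply]
    rw [map_add, LinearMap.add_apply]
  map_smul' c v := by
    ext ⟨_, φ, rfl⟩
    simp only [LinearMap.comp_apply, LinearEquiv.coe_coe, LinearMap.smul_apply, symm_range_mk]
    simp only [Submodule.mkQ_apply]
    erw [Submodule.liftQ_apply, Submodule.liftQ_apply]
    rw [map_smul, LinearMap.smul_apply, RingHom.id_apply]

/-- Green's formula. -/
theorem normalDerivDelta_apply (Ω : Opens Plane) (v : HOneDelta Ω)
    (φ : 𝓓((⊤ : Opens Plane), ℝ)) :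
    normalDerivDelta Ω v ⟨boundaryRestrict Ω φ, φ, rfl⟩ =
      ∑ i, inner ℝ (weakPartial Ω i v) (toLTwo Ω (∂_{e i} φ)) +
        inner ℝ (lapDelta Ω v) (toLTwo Ω φ) := by
  simp only [normalDerivDelta, LinearMap.coe_mk, AddHom.coe_mk, LinearMap.comp_apply,
    LinearEquiv.coe_coe, symm_range_mk, Submodule.mkQ_apply]
  rfl

/-- The normal derivative on `V`. -/
def normalDeriv (Ω : Opens Plane) : V Ω →ₗ[ℝ] Module.Dual ℝ (BoundaryFun Ω) :=
  normalDerivDelta Ω ∘ₗ V.incl Ω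

/-! ### The space `V_Γ` of normal derivatives -/

/-- The space `V_Γ` of normal derivatives `∂_n v` of functions `v ∈ V`. -/
def VGamma (Ω : Opens Plane) : Type := ↥(LinearMap.range (normalDeriv Ω))

instance (Ω : Opens Plane) : AddCommGroup (VGamma Ω) :=
  inferInstanceAs (AddCommGroup ↥(LinearMap.range (normalDeriv Ω)))

instance (Ω : Opens Plane) : Module ℝ (VGamma Ω) :=
  inferInstanceAs (Module ℝ ↥(LinearMap.range (normalDeriv Ω)))

/-- The normal derivative as a map onto `V_Γ`. -/
def dn (Ω : Opens Plane) : V Ω →ₗ[ℝ] VGamma Ω := (normalDeriv Ω).rangeRestrict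

theorem dn_surjective (Ω : Opens Plane) : Function.Surjective (dn Ω) :=
  (normalDeriv Ω).surjective_rangeRestrict

/-- The norm of `V_Γ`: `‖g‖_{V_Γ} = inf {‖v‖_V : v ∈ V, ∂_n v = g}`. -/
instance (Ω : Opens Plane) : Norm (VGamma Ω) :=
  ⟨fun g => sInf {r : ℝ | ∃ v : V Ω, dn Ω v = g ∧ ‖v‖ = r}⟩

theorem VGamma.norm_def (Ω : Opens Plane) (g : VGamma Ω) :
    ‖g‖ = sInf {r : ℝ | ∃ v : V Ω, dn Ω v = g ∧ ‖v‖ = r} := rfl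

theorem VGamma.norm_nonneg' (Ω : Opens Plane) (g : VGamma Ω) : 0 ≤ ‖g‖ := by
  refine Real.sInf_nonneg ?_
  rintro _ ⟨v, -, rfl⟩
  exact norm_nonneg v

theorem VGamma.norm_le (Ω : Opens Plane) (v : V Ω) : ‖dn Ω v‖ ≤ ‖v‖ := by
  refine csInf_le ⟨0, ?_⟩ ⟨v, rfl, rfl⟩
  rintro _ ⟨w, -, rfl⟩
  exact norm_nonneg w

theorem VGamma.exists_lt (Ω : Opens Plane) (g : VGamma Ω) (ε : ℝ) (hε : 0 < ε) :
    ∃ v : V Ω, dn Ω v = g ∧ ‖v‖ < ‖g‖ + ε := by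
  obtain ⟨v, hv⟩ := dn_surjective Ω g
  obtain ⟨_, ⟨w, hw, rfl⟩, h⟩ := exists_lt_of_csInf_lt
    (⟨_, v, hv, rfl⟩ : {r : ℝ | ∃ v : V Ω, dn Ω v = g ∧ ‖v‖ = r}.Nonempty)
    (lt_add_of_pos_right ‖g‖ hε)
  exact ⟨w, hw, h⟩

theorem VGamma.norm_smul_le' (Ω : Opens Plane) (c : ℝ) (g : VGamma Ω) :
    ‖c • g‖ ≤ ‖c‖ * ‖g‖ := by
  refine le_of_forall_pos_le_add fun ε hε => ?_
  obtain ⟨v, hv, h⟩ := VGamma.exists_lt Ω g (ε / (‖c‖ + 1)) (by positivity)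
  have h1 : ‖c • g‖ ≤ ‖c • v‖ := by
    rw [← hv, ← map_smul]
    exact VGamma.norm_le Ω _
  have h3 : ‖c • v‖ ≤ ‖c‖ * ‖v‖ := norm_smul_le c v
  have h2 : ‖c‖ * (ε / (‖c‖ + 1)) ≤ ε := by
    rw [mul_div_assoc', div_le_iff₀ (by positivity)]
    nlinarith [norm_nonneg c]
  nlinarith [mul_le_mul_of_nonneg_left h.le (norm_nonneg c)]

theorem VGamma.core (Ω : Opens Plane) : SeminormedSpace.Core ℝ (VGamma Ω) where
  norm_nonneg := VGamma.norm_nonneg' Ω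
  norm_smul c g := by
    refine le_antisymm (VGamma.norm_smul_le' Ω c g) ?_
    rcases eq_or_ne c 0 with rfl | hc
    · rw [norm_zero, zero_mul]
      exact VGamma.norm_nonneg' Ω _
    · have h := VGamma.norm_smul_le' Ω c⁻¹ (c • g)
      rw [smul_smul, inv_mul_cancel₀ hc, one_smul, norm_inv] at h
      rwa [← le_inv_mul_iff₀ (norm_pos_iff.2 hc)]
  norm_triangle g g' := by
    refine le_of_forall_pos_le_add fun ε hε => ?_
    obtain ⟨v, hv, h⟩ := VGamma.exists_lt Ω g (ε / 2) (by positivity)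
    obtain ⟨v', hv', h'⟩ := VGamma.exists_lt Ω g' (ε / 2) (by positivity)
    have h1 : ‖g + g'‖ ≤ ‖v + v'‖ := by
      rw [← hv, ← hv', ← map_add]
      exact VGamma.norm_le Ω _
    linarith [norm_add_le v v']

instance (Ω : Opens Plane) : SeminormedAddCommGroup (VGamma Ω) :=
  SeminormedAddCommGroup.ofCore (VGamma.core Ω)

instance (Ω : Opens Plane) : NormedSpace ℝ (VGamma Ω) where
  norm_smul_le := VGamma.norm_smul_le' Ω

/-! ### The very weak problem -/

/-- `y ∈ L²(Ω)` solves the very weak formulation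
`(y, Δ v)_Ω = (u, ∂_n v)_Γ - (f, v)_Ω` for all `v ∈ V`, with data `f ∈ V'` and `u ∈ V_Γ'`. -/
def IsVeryWeakSolution (Ω : Opens Plane) (f : StrongDual ℝ (V Ω)) (u : StrongDual ℝ (VGamma Ω))
    (y : LTwo Ω) : Prop :=
  ∀ v : V Ω, inner ℝ y (lap Ω v) = u (dn Ω v) - f v

end

end VeryWeak

/-!
The Laplacian `Δ : V → L²(Ω)` is a surjective isometry: it preserves norms because `‖v‖_V = ‖Δ v‖`
by definition, and it is surjective (`lap_surjective`) because the Dirichlet problem `Δ v = w`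
is solvable in `H¹_0(Ω)` for all `w ∈ L²(Ω)`. Any bounded functional on `V` is therefore of the
form `v ↦ (y, Δ v)_Ω` with a unique `y ∈ L²(Ω)`, by the Riesz representation theorem. Apply this to
`v ↦ (u, ∂_n v)_Γ - (f, v)_Ω`, which is bounded by `‖u‖ + ‖f‖` since `‖∂_n v‖_{V_Γ} ≤ ‖v‖_V`;
testing with the `v` for which `Δ v = y` gives the estimate of `y`.

The Dirichlet problem is solved by the Lax-Milgram theorem on the closure of the pairs `(φ, ∇ φ)`,
`φ ∈ C_c^∞(Ω)`, in `L²(Ω) × L²(Ω)²`. Coercivity is Poincaré's inequality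
(`norm_toLTwo_le_lineDeriv`), which for a test function follows from integrating
`∂_0 (x_0 φ) φ` by parts, since `x_0` is bounded on `Ω`.
-/

namespace VeryWeak

noncomputable section

/-! ### Poincaré's inequality -/

/-- The product `x_i φ` of a coordinate function and a test function. -/
def coordMul {Ω : Opens Plane} (i : Fin 2) (φ : 𝓓(Ω, ℝ)) : 𝓓(Ω, ℝ) :=
  ⟨fun x => x i * φ x, (contDiff_piLp_apply 2 (i := i)).mul φ.contDiff,
    φ.hasCompactSupport.mul_left, tsupport_mul_subset_right.trans φ.tsupport_subset⟩

theorem coordMul_apply {Ω : Opens Plane} (i : Fin 2) (φ : 𝓓(Ω, ℝ)) (x : Plane) :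
    coordMul i φ x = x i * φ x := rfl

theorem lineDeriv_coordMul {Ω : Opens Plane} (i : Fin 2) (φ : 𝓓(Ω, ℝ)) :
    ∂_{e i} (coordMul i φ) = φ + coordMul i (∂_{e i} φ) := by
  ext x
  have hx : HasFDerivAt (fun y : Plane => y i) (EuclideanSpace.proj i : Plane →L[ℝ] ℝ) x :=
    (EuclideanSpace.proj i : Plane →L[ℝ] ℝ).hasFDerivAt
  have hφ : HasFDerivAt φ (fderiv ℝ φ x) x :=
    (φ.contDiff.differentiable (by simp)).differentiableAt.hasFDerivAt
  have h : HasFDerivAt (coordMul i φ) _ x := hx.mul hφ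
  rw [lineDeriv_apply', h.fderiv]
  change _ = φ x + x i * (∂_{e i} φ) x
  rw [lineDeriv_apply']
  simp
  ring

theorem norm_toLTwo_coordMul_le {Ω : Opens Plane} {R : ℝ}
    (hR : ∀ x ∈ (Ω : Set Plane), ‖x‖ ≤ R) (i : Fin 2) (φ : 𝓓(Ω, ℝ)) :
    ‖toLTwo Ω (coordMul i φ)‖ ≤ R * ‖toLTwo Ω φ‖ := by
  apply Lp.norm_le_mul_norm_of_ae_le_mul
  filter_upwards [ae_restrict_mem Ω.isOpen.measurableSet, toLTwo_coe Ω (coordMul i φ),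
    toLTwo_coe Ω φ] with x hx h1 h2
  rw [h1, h2, coordMul_apply, norm_mul]
  exact mul_le_mul_of_nonneg_right ((PiLp.norm_apply_le x i).trans (hR x hx)) (norm_nonneg _)

/-- Poincaré's inequality for test functions on a bounded set. -/
theorem norm_toLTwo_le_lineDeriv {Ω : Opens Plane} {R : ℝ}
    (hR : ∀ x ∈ (Ω : Set Plane), ‖x‖ ≤ R) (i : Fin 2) (φ : 𝓓(Ω, ℝ)) :
    ‖toLTwo Ω φ‖ ≤ 2 * R * ‖toLTwo Ω (∂_{e i} φ)‖ := by
  have h := inner_lineDeriv Ω (coordMul i φ) φ (e i)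
  rw [lineDeriv_coordMul, map_add, inner_add_left, real_inner_self_eq_norm_sq] at h
  have h1 := (abs_le.1 (abs_real_inner_le_norm (toLTwo Ω (coordMul i (∂_{e i} φ)))
    (toLTwo Ω φ))).1
  have h2 := (abs_le.1 (abs_real_inner_le_norm (toLTwo Ω (coordMul i φ))
    (toLTwo Ω (∂_{e i} φ)))).1
  have h3 := mul_le_mul_of_nonneg_right (norm_toLTwo_coordMul_le hR i (∂_{e i} φ))
    (norm_nonneg (toLTwo Ω φ))
  have h4 := mul_le_mul_of_nonneg_right (norm_toLTwo_coordMul_le hR i φ)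
    (norm_nonneg (toLTwo Ω (∂_{e i} φ)))
  have key : ‖toLTwo Ω φ‖ * ‖toLTwo Ω φ‖ ≤
      2 * R * ‖toLTwo Ω (∂_{e i} φ)‖ * ‖toLTwo Ω φ‖ := by nlinarith
  rcases (norm_nonneg (toLTwo Ω φ)).eq_or_lt with h0 | h0
  · rw [← h0] at h4 ⊢
    linarith [norm_nonneg (toLTwo Ω (coordMul i φ)), norm_toLTwo_coordMul_le hR i (∂_{e i} φ),
      norm_nonneg (toLTwo Ω (coordMul i (∂_{e i} φ)))]
  · exact le_of_mul_le_mul_right key h0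

/-! ### The Dirichlet problem -/

/-- The Hilbert space `L²(Ω) × L²(Ω)²`. In contrast to the plain product, which carries the supremum
norm, it has an inner product; the topologies agree. -/
abbrev GraphSpace (Ω : Opens Plane) : Type := WithLp 2 (LTwo Ω × PiLp 2 fun _ : Fin 2 => LTwo Ω)

/-- `φ ↦ (φ, ∇ φ)` from `C_c^∞(Ω)` to the Hilbert space `L²(Ω) × L²(Ω)²`. -/
def testGraphHilbert (Ω : Opens Plane) : 𝓓(Ω, ℝ) →ₗ[ℝ] GraphSpace Ω where
  toFun φ := WithLp.toLp 2 (toLTwo Ω φ, WithLp.toLp 2 fun i => toLTwo Ω (∂_{e i} φ))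
  map_add' φ ψ := by
    simp only [LineDeriv.lineDerivOp_add, map_add]
    rfl
  map_smul' c φ := by
    simp only [LineDeriv.lineDerivOp_smul, map_smul]
    rfl

/-- `H¹_0(Ω)` as a Hilbert space: the closure of the pairs `(φ, ∇ φ)` with `φ ∈ C_c^∞(Ω)`. -/
abbrev SobolevZero (Ω : Opens Plane) : Submodule ℝ (GraphSpace Ω) :=
  (LinearMap.range (testGraphHilbert Ω)).topologicalClosure

/-- A closed condition that holds for test functions holds on `H¹_0(Ω)`. -/
theorem SobolevZero.induction {Ω : Opens Plane} {p : GraphSpace Ω → Prop}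
    (hc : IsClosed {z | p z}) (h : ∀ φ, p (testGraphHilbert Ω φ)) {z : GraphSpace Ω}
    (hz : z ∈ SobolevZero Ω) : p z := by
  refine closure_minimal (t := {z | p z}) ?_ hc hz
  rintro _ ⟨φ, rfl⟩
  exact h φ

theorem SobolevZero.hasWeakPartial {Ω : Opens Plane} {z : GraphSpace Ω} (hz : z ∈ SobolevZero Ω)
    (i : Fin 2) : HasWeakPartial Ω i z.fst (z.snd i) := by
  intro η
  refine SobolevZero.induction (p := fun z => inner ℝ z.fst (toLTwo Ω (∂_{e i} η)) =
    -inner ℝ (z.snd i) (toLTwo Ω η)) (isClosed_eq (by fun_prop) (by fun_prop)) (fun φ => ?_) hz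
  have := inner_lineDeriv Ω φ η (e i)
  change inner ℝ (toLTwo Ω φ) _ = -inner ℝ (toLTwo Ω (∂_{e i} φ)) _
  rw [this, neg_neg]

/-- Poincaré's inequality on `H¹_0(Ω)`. -/
theorem SobolevZero.norm_fst_le {Ω : Opens Plane} {R : ℝ} (hR0 : 0 ≤ R)
    (hR : ∀ x ∈ (Ω : Set Plane), ‖x‖ ≤ R) {z : GraphSpace Ω} (hz : z ∈ SobolevZero Ω) :
    ‖z.fst‖ ≤ 2 * R * ‖z.snd‖ := by
  refine SobolevZero.induction (p := fun z => ‖z.fst‖ ≤ 2 * R * ‖z.snd‖)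
    (isClosed_le (by fun_prop) (by fun_prop)) (fun φ => ?_) hz
  refine (norm_toLTwo_le_lineDeriv hR 0 φ).trans (mul_le_mul_of_nonneg_left ?_ (by positivity))
  exact PiLp.norm_apply_le (testGraphHilbert Ω φ).snd 0

/-- The Lax-Milgram theorem for the form `(z, t) ↦ (z₂, t₂)` on a closed subspace of a product, where
`‖z₁‖ ≤ C ‖z₂‖` makes the form coercive. -/
theorem exists_forall_inner_snd_eq {E F : Type*} [NormedAddCommGroup E] [InnerProductSpace ℝ E]
    [NormedAddCommGroup F] [InnerProductSpace ℝ F] (K : Submodule ℝ (WithLp 2 (E × F)))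
    [CompleteSpace K] (C : ℝ) (hC : ∀ z ∈ K, ‖z.fst‖ ≤ C * ‖z.snd‖) (w : E) :
    ∃ z ∈ K, ∀ t ∈ K, inner ℝ z.snd t.snd = inner ℝ w t.fst := by
  let P : K →L[ℝ] F := WithLp.sndL 2 ℝ E F ∘L K.subtypeL
  let B : K →L[ℝ] K →L[ℝ] ℝ := (innerSL ℝ).bilinearComp P P
  let l : StrongDual ℝ K := innerSL ℝ w ∘L WithLp.fstL 2 ℝ E F ∘L K.subtypeL
  have hB : IsCoercive B := by
    refine ⟨(C ^ 2 + 1)⁻¹, by positivity, fun z => ?_⟩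
    change _ ≤ inner ℝ (z : WithLp 2 (E × F)).snd (z : WithLp 2 (E × F)).snd
    have h := pow_le_pow_left₀ (norm_nonneg _) (hC z z.2) 2
    have hn := WithLp.prod_norm_sq_eq_of_L2 (z : WithLp 2 (E × F))
    rw [real_inner_self_eq_norm_sq, mul_assoc, inv_mul_le_iff₀ (by positivity), ← sq,
      Submodule.coe_norm, hn]
    rw [mul_pow] at h
    linarith
  let z := hB.continuousLinearEquivOfBilin.symm ((InnerProductSpace.toDual ℝ K).symm l)
  refine ⟨z, z.2, fun t ht => ?_⟩
  have h := hB.continuousLinearEquivOfBilin_apply z ⟨t, ht⟩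
  rw [ContinuousLinearEquiv.apply_symm_apply, InnerProductSpace.toDual_symm_apply] at h
  exact h.symm

theorem exists_weak_solution {Ω : Opens Plane} (hb : Bornology.IsBounded (Ω : Set Plane))
    (w : LTwo Ω) : ∃ z ∈ SobolevZero Ω,
      ∀ φ : 𝓓(Ω, ℝ), ∑ i, inner ℝ (z.snd i) (toLTwo Ω (∂_{e i} φ)) = -inner ℝ w (toLTwo Ω φ) := by
  obtain ⟨R, hR0, hR⟩ := hb.exists_pos_norm_le
  obtain ⟨z, hz, h⟩ := exists_forall_inner_snd_eq (SobolevZero Ω) (2 * R)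
    (fun z hz => SobolevZero.norm_fst_le hR0.le hR hz) (-w)
  refine ⟨z, hz, fun φ => ?_⟩
  have hφ := h (testGraphHilbert Ω φ) (Submodule.le_topologicalClosure _ ⟨φ, rfl⟩)
  rw [PiLp.inner_apply, inner_neg_left] at hφ
  exact hφ

/-- The Dirichlet problem `Δ v = w` has a solution in `V` for all `w ∈ L²(Ω)`. -/
theorem lap_surjective {Ω : Opens Plane} (hb : Bornology.IsBounded (Ω : Set Plane)) :
    Function.Surjective (lap Ω) := by
  intro w
  obtain ⟨z, hz, hw⟩ := exists_weak_solution hb w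
  have hp := SobolevZero.hasWeakPartial hz
  let v : HOne Ω := ⟨z.fst, fun i => ⟨_, hp i⟩⟩
  have hlap : HasWeakLaplacian Ω v w := by
    intro φ
    rw [map_sum, inner_sum]
    have := hw φ
    simp only [fun i => hp i (∂_{e i} φ), v, Finset.sum_neg_distrib]
    linarith
  have h0 : v ∈ HOneZero Ω := by
    have hv : sobolevGraph Ω v = (z.fst, fun i => z.snd i) :=
      Prod.ext rfl (funext fun i => (weakPartial_spec Ω i v).unique (hp i))
    change sobolevGraph Ω v ∈ closure _
    rw [hv]
    refine map_mem_closure (f := fun z : GraphSpace Ω => (z.fst, fun i => z.snd i))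
      (by fun_prop) hz ?_
    rintro _ ⟨φ, rfl⟩
    exact ⟨φ, rfl⟩
  exact ⟨⟨v, h0, w, hlap⟩, (lapDelta_spec Ω ⟨v, w, hlap⟩).unique hlap⟩

/-! ### Very weak solutions -/

/-- A bounded functional on `V` is represented by an element of `L²(Ω)` through the Laplacian. -/
theorem exists_inner_lap_eq {Ω : Opens Plane} (hs : Function.Surjective (lap Ω))
    (l : V Ω →ₗ[ℝ] ℝ) (C : ℝ) (hl : ∀ v, |l v| ≤ C * ‖v‖) :
    ∃ y : LTwo Ω, ∀ v, inner ℝ y (lap Ω v) = l v := by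
  obtain ⟨g, hg⟩ := (lap Ω).exists_rightInverse_of_surjective (LinearMap.range_eq_top.2 hs)
  have hg' : ∀ w, lap Ω (g w) = w := fun w => LinearMap.congr_fun hg w
  let F : StrongDual ℝ (LTwo Ω) := (l ∘ₗ g).mkContinuous C fun w => by
    have := hl (g w)
    rwa [V.norm_def, hg'] at this
  refine ⟨(InnerProductSpace.toDual ℝ _).symm F, fun v => ?_⟩
  rw [InnerProductSpace.toDual_symm_apply]
  change l (g (lap Ω v)) = l v
  -- `g (Δ v)` and `v` have the same Laplacian, so the seminorm of their difference vanishes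
  have h := hl (g (lap Ω v) - v)
  rw [V.norm_def, map_sub (lap Ω), hg', sub_self, norm_zero, mul_zero] at h
  rw [← sub_eq_zero, ← map_sub]
  exact abs_nonpos_iff.1 h

theorem abs_data_le (Ω : Opens Plane) (f : StrongDual ℝ (V Ω)) (u : StrongDual ℝ (VGamma Ω))
    (v : V Ω) : |u (dn Ω v) - f v| ≤ (‖u‖ + ‖f‖) * ‖v‖ := by
  have h1 : ‖u (dn Ω v)‖ ≤ ‖u‖ * ‖v‖ := u.le_opNorm_of_le (VGamma.norm_le Ω v)
  have h2 : ‖f v‖ ≤ ‖f‖ * ‖v‖ := f.le_opNorm v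
  rw [add_mul]
  exact (norm_sub_le (u (dn Ω v)) (f v)).trans (add_le_add h1 h2)

theorem IsVeryWeakSolution.unique {Ω : Opens Plane} (hs : Function.Surjective (lap Ω))
    {f : StrongDual ℝ (V Ω)} {u : StrongDual ℝ (VGamma Ω)} {y y' : LTwo Ω}
    (h : IsVeryWeakSolution Ω f u y) (h' : IsVeryWeakSolution Ω f u y') : y = y' := by
  refine ext_inner_right ℝ fun w => ?_
  obtain ⟨v, rfl⟩ := hs w
  rw [h v, h' v]

theorem IsVeryWeakSolution.norm_le {Ω : Opens Plane} (hs : Function.Surjective (lap Ω))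
    {f : StrongDual ℝ (V Ω)} {u : StrongDual ℝ (VGamma Ω)} {y : LTwo Ω}
    (h : IsVeryWeakSolution Ω f u y) : ‖y‖ ≤ ‖u‖ + ‖f‖ := by
  obtain ⟨v, hv⟩ := hs y
  have h1 := h v
  have h2 := (le_abs_self _).trans (abs_data_le Ω f u v)
  rw [← h1, V.norm_def, hv, real_inner_self_eq_norm_mul_norm] at h2
  rcases (norm_nonneg y).eq_or_lt with h0 | h0
  · rw [← h0]
    exact add_nonneg (norm_nonneg u) (norm_nonneg f)
  · exact le_of_mul_le_mul_right h2 h0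

end

end VeryWeak

theorem mainTheorem4 (Ω : TopologicalSpace.Opens VeryWeak.Plane)
    (hΩ : VeryWeak.IsPolygonalDomain Ω)
    (f : StrongDual ℝ (VeryWeak.V Ω)) (u : StrongDual ℝ (VeryWeak.VGamma Ω)) :
    (∃! y : VeryWeak.LTwo Ω, VeryWeak.IsVeryWeakSolution Ω f u y) ∧
      ∀ y : VeryWeak.LTwo Ω, VeryWeak.IsVeryWeakSolution Ω f u y → ‖y‖ ≤ ‖u‖ + ‖f‖ := by
  have hs := VeryWeak.lap_surjective hΩ.bounded
  obtain ⟨y, hy⟩ := VeryWeak.exists_inner_lap_eq hs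
    (u.toLinearMap ∘ₗ VeryWeak.dn Ω - f.toLinearMap) (‖u‖ + ‖f‖) (VeryWeak.abs_data_le Ω f u)
  exact ⟨⟨y, hy, fun y' hy' => hy'.unique hs hy⟩, fun y' hy' => hy'.norm_le hs⟩
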